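/- Let $\alpha\in\mathbb{R}$, let $\theta\in\mathbb{R}$ with $\theta/2\pi$ irrational, and let $f:\mathbb{T}\to\mathbb{T}$ be a continuous function on the unit circle. Let $\mathbb{A}_\alpha$ be the noncommutative torus, i.e. the universal unital $C^*$-algebra generated by two unitaries $U,V$ with $UV=e^{2\pi i\alpha}VU$; let $\tau$ be its canonical tracial state, determined by $\tau(U^mV^n)=\delta_{m,0}\delta_{n,0}$ for $m,n\in\mathbb{Z}$; and let $\Phi_{\theta,f}$ be the Anzai skew-product, i.e. the unique $*$-automorphism of $\mathbb{A}_\alpha$ with $\Phi_{\theta,f}(U)=e^{i\theta}U$ and $\Phi_{\theta,f}(V)=f(U)V$, where $f(U)$ is given by the continuous functional calculus. A state $\omega$ of $\mathbb{A}_\alpha$ is called invariant if $\omega\circ\Phi_{\theta,f}=\omega$. Suppose that $(\mathbb{A}_\alpha,\Phi_{\theta,f},\tau)$ is ergodic, i.e. that $\tau$ is an extreme point of the convex set of invariant states. Then $(\mathbb{A}_\alpha,\Phi_{\theta,f})$ is uniquely ergodic, i.e. it has exactly one invariant state, and this unique invariant state is $\tau$. -/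

import Mathlib

noncomputable section

namespace NCTorus

/-- The conjugate-linear antiautomorphism of the group algebra `ℂ[G]` with `g ↦ g⁻¹`. -/
def groupAlgebraStar (G : Type) [Group G] :
    MonoidAlgebra ℂ G →+* (MonoidAlgebra ℂ G)ᵐᵒᵖ :=
  MonoidAlgebra.liftNCRingHom
    ((algebraMap ℂ (MonoidAlgebra ℂ G)ᵐᵒᵖ).comp (starRingEnd ℂ))
    ({ toFun := fun g => MulOpposite.op (MonoidAlgebra.of ℂ G g⁻¹)
       map_one' := by rw [inv_one, map_one, MulOpposite.op_one]
       map_mul' := fun g h => by rw [mul_inv_rev, map_mul, MulOpposite.op_mul] } :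
      G →* (MonoidAlgebra ℂ G)ᵐᵒᵖ)
    (fun c _ => Algebra.commutes (starRingEnd ℂ c) _)

theorem groupAlgebraStar_of {G : Type} [Group G] (g : G) :
    groupAlgebraStar G (MonoidAlgebra.of ℂ G g) = MulOpposite.op (MonoidAlgebra.of ℂ G g⁻¹) :=
  (MonoidAlgebra.liftNC_single _ _ _ _).trans (by
    rw [AddMonoidHom.coe_coe, map_one, one_mul]; rfl)

theorem groupAlgebraStar_algebraMap {G : Type} [Group G] (c : ℂ) :
    groupAlgebraStar G (algebraMap ℂ _ c) = algebraMap ℂ (MonoidAlgebra ℂ G)ᵐᵒᵖ (star c) :=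
  (MonoidAlgebra.liftNC_single _ _ _ _).trans (by simp [← MonoidAlgebra.one_def])

/-- The group algebra `ℂ[F₂]` of the free group on two letters, i.e. the *-algebra of
noncommutative Laurent polynomials in two unitary indeterminates. The parameter `α` is carried
along because the seminorm below depends on it. -/
def Pre (_α : ℝ) : Type := MonoidAlgebra ℂ (FreeGroup (Fin 2))

variable (α : ℝ)

instance : Ring (Pre α) := inferInstanceAs (Ring (MonoidAlgebra ℂ (FreeGroup (Fin 2))))
instance : Algebra ℂ (Pre α) :=
  inferInstanceAs (Algebra ℂ (MonoidAlgebra ℂ (FreeGroup (Fin 2))))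

/-- A word in the two unitary indeterminates, as an element of the group algebra. -/
def Pre.word : FreeGroup (Fin 2) →* Pre α := MonoidAlgebra.of ℂ (FreeGroup (Fin 2))

theorem Pre.induction {P : Pre α → Prop} (x : Pre α)
    (hw : ∀ g, P (Pre.word α g)) (ha : ∀ x y, P x → P y → P (x + y))
    (hs : ∀ (c : ℂ) x, P x → P (c • x)) : P x :=
  MonoidAlgebra.induction_on x hw ha hs

/-- The involution of `ℂ[F₂]`, as a ring homomorphism to the opposite ring. -/
def Pre.starHom : Pre α →+* (Pre α)ᵐᵒᵖ := groupAlgebraStar (FreeGroup (Fin 2))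

instance : Star (Pre α) := ⟨fun x => (Pre.starHom α x).unop⟩

theorem Pre.star_def (x : Pre α) : star x = (Pre.starHom α x).unop := rfl

theorem Pre.star_word (g : FreeGroup (Fin 2)) :
    star (Pre.word α g) = Pre.word α g⁻¹ := by
  rw [Pre.star_def]
  exact congrArg MulOpposite.unop (groupAlgebraStar_of g)

theorem Pre.star_algebraMap (c : ℂ) :
    star (algebraMap ℂ (Pre α) c) = algebraMap ℂ (Pre α) (star c) := by
  rw [Pre.star_def]
  exact congrArg MulOpposite.unop (groupAlgebraStar_algebraMap c)

theorem Pre.star_add' (x y : Pre α) : star (x + y) = star x + star y := by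
  simp [Pre.star_def]

theorem Pre.star_mul' (x y : Pre α) : star (x * y) = star y * star x := by
  simp [Pre.star_def]

theorem Pre.star_smul' (c : ℂ) (x : Pre α) : star (c • x) = star c • star x := by
  rw [Algebra.smul_def, Pre.star_mul', Pre.star_algebraMap, Algebra.smul_def,
    Algebra.commutes]

instance : StarRing (Pre α) where
  star_involutive x := by
    induction x using Pre.induction α with
    | hw g => simp [Pre.star_word]
    | ha x y hx hy => rw [Pre.star_add', Pre.star_add', hx, hy]
    | hs c x hx => rw [Pre.star_smul', Pre.star_smul', hx, star_star]
  star_mul := Pre.star_mul' α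
  star_add := Pre.star_add' α

instance : StarModule ℂ (Pre α) := ⟨Pre.star_smul' α⟩

/-- The C*-seminorms on `ℂ[F₂]` for which the relation `U V = e^{2πiα} V U` holds. -/
structure IsTorusSeminorm (p : Seminorm ℂ (Pre α)) : Prop where
  mul_le : ∀ x y, p (x * y) ≤ p x * p y
  star_mul_self : ∀ x, p (star x * x) = p x ^ 2
  rel : p (Pre.word α (FreeGroup.of 0) * Pre.word α (FreeGroup.of 1) -
    Complex.exp (2 * Real.pi * Complex.I * α) •
      (Pre.word α (FreeGroup.of 1) * Pre.word α (FreeGroup.of 0))) = 0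

variable {α}

theorem IsTorusSeminorm.word_le {p : Seminorm ℂ (Pre α)} (hp : IsTorusSeminorm α p)
    (g : FreeGroup (Fin 2)) : p (Pre.word α g) ≤ 1 := by
  have h1 : p 1 ≤ 1 := by
    have h := hp.star_mul_self 1
    rw [star_one, one_mul] at h
    nlinarith [apply_nonneg p 1]
  have h2 := hp.star_mul_self (Pre.word α g)
  rw [Pre.star_word, ← map_mul, inv_mul_cancel, map_one] at h2
  nlinarith [apply_nonneg p (Pre.word α g)]

theorem exists_bound (x : Pre α) :
    ∃ C, ∀ p : Seminorm ℂ (Pre α), IsTorusSeminorm α p → p x ≤ C := by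
  induction x using Pre.induction α with
  | hw g => exact ⟨1, fun p hp => hp.word_le g⟩
  | ha x y hx hy =>
    obtain ⟨C, hC⟩ := hx
    obtain ⟨D, hD⟩ := hy
    exact ⟨C + D, fun p hp => (map_add_le_add p x y).trans (add_le_add (hC p hp) (hD p hp))⟩
  | hs c x hx =>
    obtain ⟨C, hC⟩ := hx
    exact ⟨‖c‖ * C, fun p hp => by
      rw [map_smul_eq_mul]; exact mul_le_mul_of_nonneg_left (hC p hp) (norm_nonneg c)⟩

theorem bddAbove (x : Pre α) :
    BddAbove (Set.range fun p : {p : Seminorm ℂ (Pre α) // IsTorusSeminorm α p} => p.1 x) := by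
  obtain ⟨C, hC⟩ := exists_bound x
  exact ⟨C, by rintro _ ⟨p, rfl⟩; exact hC p.1 p.2⟩

instance : Nonempty {p : Seminorm ℂ (Pre α) // IsTorusSeminorm α p} :=
  ⟨0, by constructor <;> simp⟩

theorem IsTorusSeminorm.star_le {p : Seminorm ℂ (Pre α)} (hp : IsTorusSeminorm α p)
    (x : Pre α) : p (star x) ≤ p x := by
  have h := hp.star_mul_self (star x)
  have h2 := hp.mul_le (star (star x)) (star x)
  rw [h, star_star] at h2
  have := apply_nonneg p x
  have := apply_nonneg p (star x)
  by_contra hc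
  push Not at hc
  nlinarith

variable (α)

/-- The largest C*-seminorm. -/
def univNorm (x : Pre α) : ℝ :=
  ⨆ p : {p : Seminorm ℂ (Pre α) // IsTorusSeminorm α p}, p.1 x

variable {α}

theorem le_univNorm {p : Seminorm ℂ (Pre α)} (hp : IsTorusSeminorm α p) (x : Pre α) :
    p x ≤ univNorm α x := le_ciSup (bddAbove x) ⟨p, hp⟩

theorem univNorm_le {x : Pre α} {C : ℝ}
    (h : ∀ p : Seminorm ℂ (Pre α), IsTorusSeminorm α p → p x ≤ C) : univNorm α x ≤ C :=
  ciSup_le fun p => h p.1 p.2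

theorem univNorm_nonneg (x : Pre α) : 0 ≤ univNorm α x :=
  Real.iSup_nonneg fun p => apply_nonneg p.1 x

theorem univNorm_add_le (x y : Pre α) : univNorm α (x + y) ≤ univNorm α x + univNorm α y :=
  univNorm_le fun p hp =>
    (map_add_le_add p x y).trans (add_le_add (le_univNorm hp x) (le_univNorm hp y))

theorem univNorm_smul_le (c : ℂ) (x : Pre α) : univNorm α (c • x) ≤ ‖c‖ * univNorm α x :=
  univNorm_le fun p hp => by
    rw [map_smul_eq_mul]; exact mul_le_mul_of_nonneg_left (le_univNorm hp x) (norm_nonneg c)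

theorem univNorm_mul_le (x y : Pre α) : univNorm α (x * y) ≤ univNorm α x * univNorm α y :=
  univNorm_le fun p hp => (hp.mul_le x y).trans
    (mul_le_mul (le_univNorm hp x) (le_univNorm hp y) (apply_nonneg p y) (univNorm_nonneg x))

theorem univNorm_star_le (x : Pre α) : univNorm α (star x) ≤ univNorm α x :=
  univNorm_le fun _ hp => (hp.star_le x).trans (le_univNorm hp x)

theorem univNorm_sq_le (x : Pre α) : univNorm α x * univNorm α x ≤ univNorm α (star x * x) := by
  have h0 := univNorm_nonneg (star x * x)
  have : univNorm α x ≤ √(univNorm α (star x * x)) := univNorm_le fun p hp => by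
    apply Real.le_sqrt_of_sq_le
    rw [← hp.star_mul_self]; exact le_univNorm hp _
  calc _ ≤ √(univNorm α (star x * x)) * √(univNorm α (star x * x)) :=
        mul_self_le_mul_self (univNorm_nonneg x) this
    _ = _ := Real.mul_self_sqrt h0

variable (α)

/-- The largest C*-seminorm, as a seminorm. -/
def univSeminorm : Seminorm ℂ (Pre α) :=
  Seminorm.ofSMulLE (univNorm α)
    (le_antisymm (univNorm_le fun _ _ => by simp) (univNorm_nonneg 0))
    univNorm_add_le univNorm_smul_le

instance : SeminormedRing (Pre α) where
  __ := (univSeminorm α).toAddGroupSeminorm.toSeminormedAddCommGroup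
  __ := (inferInstance : Ring (Pre α))
  norm_mul_le := univNorm_mul_le

theorem Pre.norm_def (x : Pre α) : ‖x‖ = univNorm α x := rfl

instance : NormedAlgebra ℂ (Pre α) where
  norm_smul_le := univNorm_smul_le

instance : NormedStarGroup (Pre α) := ⟨univNorm_star_le⟩

end NCTorus

open UniformSpace in
/-- The noncommutative torus `𝔸_α`: the universal unital C*-algebra generated by unitaries `U`, `V`
with `U V = e^{2πiα} V U`, constructed as the Hausdorff completion of `ℂ[F₂]` in the largest
C*-seminorm compatible with the relation. Its universal property is `NCTorus.lift` together with
`NCTorus.lift_U`, `NCTorus.lift_V` and `NCTorus.hom_ext`. -/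
def NCTorus (α : ℝ) : Type := Completion (NCTorus.Pre α)

namespace NCTorus
open UniformSpace

variable (α : ℝ)

instance : NormedRing (NCTorus α) := inferInstanceAs (NormedRing (Completion (Pre α)))
instance : CompleteSpace (NCTorus α) := inferInstanceAs (CompleteSpace (Completion (Pre α)))
instance : Algebra ℂ (NCTorus α) := inferInstanceAs (Algebra ℂ (Completion (Pre α)))
instance : NormedSpace ℂ (NCTorus α) := inferInstanceAs (NormedSpace ℂ (Completion (Pre α)))
instance : NormedAlgebra ℂ (NCTorus α) where
  norm_smul_le := norm_smul_le (α := ℂ) (β := Completion (Pre α))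

/-- The canonical map `ℂ[F₂] → 𝔸_α`. -/
def ofPre : Pre α →ₐ[ℂ] NCTorus α where
  __ := (Completion.coeRingHom : Pre α →+* Completion (Pre α))
  commutes' _ := rfl

theorem isometry_ofPre : Isometry (ofPre α) := Completion.coe_isometry

theorem denseRange_ofPre : DenseRange (ofPre α) := Completion.denseRange_coe

instance : Star (NCTorus α) := ⟨Completion.map (star : Pre α → Pre α)⟩

theorem star_ofPre (x : Pre α) : star (ofPre α x) = ofPre α (star x) :=
  Completion.map_coe star_isometry.uniformContinuous x

theorem continuous_star' : Continuous (star : NCTorus α → NCTorus α) :=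
  Completion.continuous_map

theorem induction {P : NCTorus α → Prop} (x : NCTorus α) (hc : IsClosed {x | P x})
    (h : ∀ x, P (ofPre α x)) : P x :=
  (denseRange_ofPre α).induction_on x hc h

instance : CStarAlgebra (NCTorus α) where
  star_involutive x := by
    refine induction α (P := fun x => star (star x) = x) x
      (isClosed_eq ((continuous_star' α).comp (continuous_star' α)) continuous_id) fun x => ?_
    rw [star_ofPre, star_ofPre, star_star]
  star_mul x y := by
    refine (denseRange_ofPre α).induction_on₂ (p := fun x y => star (x * y) = star y * star x)
      (isClosed_eq ((continuous_star' α).comp continuous_mul)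
        (((continuous_star' α).comp continuous_snd).mul
          ((continuous_star' α).comp continuous_fst))) (fun x y => ?_) x y
    rw [← map_mul, star_ofPre, star_ofPre, star_ofPre, star_mul, map_mul]
  star_add x y := by
    refine (denseRange_ofPre α).induction_on₂ (p := fun x y => star (x + y) = star x + star y)
      (isClosed_eq ((continuous_star' α).comp continuous_add)
        (((continuous_star' α).comp continuous_fst).add
          ((continuous_star' α).comp continuous_snd))) (fun x y => ?_) x y
    rw [← map_add, star_ofPre, star_ofPre, star_ofPre, star_add, map_add]
  star_smul c x := by
    refine induction α (P := fun x => star (c • x) = star c • star x) x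
      (isClosed_eq ((continuous_star' α).comp (continuous_const_smul c))
        ((continuous_const_smul (star c)).comp (continuous_star' α))) fun x => ?_
    rw [← map_smul, star_ofPre, star_ofPre, star_smul, map_smul]
  norm_mul_self_le x := by
    refine induction α (P := fun x => ‖x‖ * ‖x‖ ≤ ‖star x * x‖) x
      (isClosed_le (continuous_norm.mul continuous_norm)
        (continuous_norm.comp ((continuous_star' α).mul continuous_id))) fun x => ?_
    rw [star_ofPre, ← map_mul, ← dist_zero_right, ← dist_zero_right (ofPre α (_ * _)),
      ← map_zero (ofPre α), (isometry_ofPre α).dist_eq, (isometry_ofPre α).dist_eq,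
      dist_zero_right, dist_zero_right]
    exact univNorm_sq_le x

/-- The image in `𝔸_α` of a word in the two unitary indeterminates. -/
def word : FreeGroup (Fin 2) →* unitary (NCTorus α) where
  toFun g := ⟨ofPre α (Pre.word α g), by
    rw [Unitary.mem_iff, star_ofPre, Pre.star_word, ← map_mul, ← map_mul, ← map_mul, ← map_mul]
    simp⟩
  map_one' := by ext; simp
  map_mul' g h := by ext; simp

/-- The first generator of `𝔸_α`. -/
def U : unitary (NCTorus α) := word α (FreeGroup.of 0)

/-- The second generator of `𝔸_α`. -/
def V : unitary (NCTorus α) := word α (FreeGroup.of 1)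

end NCTorus

/-- The commutation relation `u v = e^{2πiα} v u`. -/
def TorusRelation (α : ℝ) {B : Type*} [CStarAlgebra B] (u v : unitary B) : Prop :=
  (u : B) * v = Complex.exp (2 * Real.pi * Complex.I * α) • ((v : B) * u)

namespace NCTorus
open UniformSpace

variable (α : ℝ)

theorem torusRelation_U_V : TorusRelation α (U α) (V α) := by
  have : ‖Pre.word α (FreeGroup.of 0) * Pre.word α (FreeGroup.of 1) -
    Complex.exp (2 * Real.pi * Complex.I * α) •
      (Pre.word α (FreeGroup.of 1) * Pre.word α (FreeGroup.of 0))‖ = 0 :=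
    le_antisymm (univNorm_le fun _ hp => hp.rel.le) (norm_nonneg _)
  rw [← dist_zero_right, ← (isometry_ofPre α).dist_eq, map_zero, dist_zero_right, norm_eq_zero,
    map_sub, map_smul, map_mul, map_mul, sub_eq_zero] at this
  exact this

variable {α} {B : Type*} [CStarAlgebra B]

/-- The *-homomorphism `ℂ[F₂] → B` sending the two letters to `u` and `v`. -/
def preLift (α : ℝ) (u v : unitary B) : Pre α →ₐ[ℂ] B :=
  MonoidAlgebra.lift ℂ B (FreeGroup (Fin 2))
    ((unitary B).subtype.comp (FreeGroup.lift ![u, v]))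

theorem preLift_word (u v : unitary B) (g : FreeGroup (Fin 2)) :
    preLift α u v (Pre.word α g) = (FreeGroup.lift ![u, v] g : unitary B) :=
  MonoidAlgebra.lift_of _ g

theorem preLift_star (u v : unitary B) (x : Pre α) :
    preLift α u v (star x) = star (preLift α u v x) := by
  induction x using Pre.induction α with
  | hw g => rw [Pre.star_word, preLift_word, preLift_word, map_inv]; rfl
  | ha x y hx hy => rw [star_add, map_add, map_add, star_add, hx, hy]
  | hs c x hx => rw [star_smul, map_smul, map_smul, star_smul, hx]

theorem norm_preLift_le {u v : unitary B} (h : TorusRelation α u v) (x : Pre α) :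
    ‖preLift α u v x‖ ≤ ‖x‖ := by
  refine le_univNorm (p := (normSeminorm ℂ B).comp (preLift α u v).toLinearMap) ⟨?_, ?_, ?_⟩ x
  · intro x y
    simpa using norm_mul_le (preLift α u v x) (preLift α u v y)
  · intro x
    simp [preLift_star, CStarRing.norm_star_mul_self, sq]
  · have : (u : B) * v - Complex.exp (2 * Real.pi * Complex.I * α) • ((v : B) * u) = 0 :=
      sub_eq_zero.2 h
    simpa [preLift_word] using this

theorem continuous_preLift {u v : unitary B} (h : TorusRelation α u v) :
    Continuous (preLift α u v : Pre α →+* B) :=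
  AddMonoidHomClass.continuous_of_bound (preLift α u v) 1 fun x => by
    rw [one_mul]; exact norm_preLift_le h x

/-- The extension of `preLift` to the completion. -/
def liftRingHom (u v : unitary B) (h : TorusRelation α u v) : NCTorus α →+* B :=
  Completion.extensionHom (preLift α u v : Pre α →+* B) (continuous_preLift h)

theorem liftRingHom_ofPre (u v : unitary B) (h : TorusRelation α u v) (x : Pre α) :
    liftRingHom u v h (ofPre α x) = preLift α u v x :=
  Completion.extensionHom_coe (preLift α u v : Pre α →+* B) (continuous_preLift h) x

theorem continuous_liftRingHom (u v : unitary B) (h : TorusRelation α u v) :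
    Continuous (liftRingHom u v h) :=
  Completion.continuous_extension (f := (preLift α u v : Pre α → B))

/-- The universal property of `𝔸_α`: the *-homomorphism with `U ↦ u`, `V ↦ v`. -/
def lift (u v : unitary B) (h : TorusRelation α u v) : NCTorus α →⋆ₐ[ℂ] B where
  __ := liftRingHom u v h
  commutes' c := (liftRingHom_ofPre u v h _).trans ((preLift α u v).commutes c)
  map_star' x := by
    refine induction α (P := fun x => liftRingHom u v h (star x) = star (liftRingHom u v h x)) x
      (isClosed_eq ((continuous_liftRingHom u v h).comp (continuous_star' α))
        (continuous_star.comp (continuous_liftRingHom u v h))) fun x => ?_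
    rw [star_ofPre, liftRingHom_ofPre, liftRingHom_ofPre, preLift_star]

theorem lift_ofPre (u v : unitary B) (h : TorusRelation α u v) (x : Pre α) :
    lift u v h (ofPre α x) = preLift α u v x :=
  liftRingHom_ofPre u v h x

@[simp]
theorem lift_U (u v : unitary B) (h : TorusRelation α u v) : lift u v h (U α) = u :=
  (lift_ofPre u v h _).trans ((preLift_word u v _).trans (by simp))

@[simp]
theorem lift_V (u v : unitary B) (h : TorusRelation α u v) : lift u v h (V α) = v :=
  (lift_ofPre u v h _).trans ((preLift_word u v _).trans (by simp))

theorem continuous_starAlgHom {A : Type*} [CStarAlgebra A] (φ : A →⋆ₐ[ℂ] B) : Continuous φ :=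
  AddMonoidHomClass.continuous_of_bound φ 1 fun x => by
    rw [one_mul]; exact NonUnitalStarAlgHom.norm_apply_le φ x

theorem hom_ext {φ ψ : NCTorus α →⋆ₐ[ℂ] B} (hU : φ (U α) = ψ (U α)) (hV : φ (V α) = ψ (V α)) :
    φ = ψ := by
  have key : ((φ : NCTorus α →* B).comp ((unitary (NCTorus α)).subtype.comp (word α))) =
      ((ψ : NCTorus α →* B).comp ((unitary (NCTorus α)).subtype.comp (word α))) := by
    ext i
    fin_cases i
    · exact hU
    · exact hV
  refine StarAlgHom.ext fun x => ?_
  refine induction α (P := fun x => φ x = ψ x) x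
    (isClosed_eq (continuous_starAlgHom φ) (continuous_starAlgHom ψ)) fun x => ?_
  induction x using Pre.induction α with
  | hw g => exact DFunLike.congr_fun key g
  | ha x y hx hy => rw [map_add, map_add, map_add, hx, hy]
  | hs c x hx => rw [map_smul, map_smul, map_smul, hx]


/-- The continuous functional calculus `f ↦ f(u)` of a unitary `u`, for `f` on the circle. -/
def circleFC (u : unitary B) : C(Circle, ℂ) →⋆ₐ[ℂ] B :=
  (cfcHom (R := ℂ) (a := (u : B)) (inferInstance : IsStarNormal (u : B))).comp
    (ContinuousMap.compStarAlgHom' ℂ ℂ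
      ⟨fun z => (⟨z.1, by
        simpa [Submonoid.unitSphere] using Unitary.spectrum_subset_circle u z.2⟩ : Circle),
        by fun_prop⟩)

/-- The inclusion function `𝕋 → ℂ`. -/
def circleCoe : C(Circle, ℂ) := ⟨fun z => (z : ℂ), by fun_prop⟩

theorem circleFC_coe (u : unitary B) : circleFC u circleCoe = u :=
  cfcHom_id (R := ℂ) (a := (u : B)) (inferInstance : IsStarNormal (u : B))

theorem circleHom_ext {φ ψ : C(Circle, ℂ) →⋆ₐ[ℂ] B} (h : φ circleCoe = ψ circleCoe) :
    φ = ψ := by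
  have : CompactSpace ((Submonoid.unitSphere ℂ : Set ℂ)) :=
    inferInstanceAs (CompactSpace Circle)
  refine ContinuousMap.starAlgHom_ext_map_X (s := (Submonoid.unitSphere ℂ : Set ℂ))
    (continuous_starAlgHom φ) (continuous_starAlgHom ψ) ?_
  have hX : (Polynomial.toContinuousMapOnAlgHom (Submonoid.unitSphere ℂ : Set ℂ) Polynomial.X :
      C((Submonoid.unitSphere ℂ : Set ℂ), ℂ)) = (circleCoe : C(Circle, ℂ)) :=
    ContinuousMap.ext fun z => Polynomial.eval_X (x := (z : ℂ))
  rw [hX]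
  exact h

theorem map_circleFC {C : Type*} [CStarAlgebra C] (φ : B →⋆ₐ[ℂ] C) (u : unitary B)
    (v : unitary C) (h : φ u = v) (g : C(Circle, ℂ)) : φ (circleFC u g) = circleFC v g := by
  have : φ.comp (circleFC u) = circleFC v := circleHom_ext <| by
    rw [StarAlgHom.comp_apply, circleFC_coe, circleFC_coe, h]
  exact DFunLike.congr_fun this g

theorem star_coe_mul_coe (z : Circle) : star (z : ℂ) * (z : ℂ) = 1 := by
  rw [← starRingEnd_apply, ← Circle.coe_inv_eq_conj, ← Circle.coe_mul, inv_mul_cancel,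
    Circle.coe_one]

/-- The unitary `z u` for `z` in the circle. -/
def rotate (z : Circle) (u : unitary B) : unitary B :=
  ⟨(z : ℂ) • (u : B), by
    rw [Unitary.mem_iff, star_smul, smul_mul_smul_comm, smul_mul_smul_comm,
      mul_comm (z : ℂ), star_coe_mul_coe, one_smul, one_smul]
    exact Unitary.mem_iff.1 u.2⟩

theorem coe_rotate (z : Circle) (u : unitary B) : (rotate z u : B) = (z : ℂ) • (u : B) := rfl

theorem circleFC_rotate (z : Circle) (u : unitary B) (g : C(Circle, ℂ)) :
    circleFC (rotate z u) g = circleFC u (g.comp ⟨fun w => z * w, by fun_prop⟩) := by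
  have : circleFC (rotate z u) =
      (circleFC u).comp (ContinuousMap.compStarAlgHom' ℂ ℂ ⟨fun w => z * w, by fun_prop⟩) :=
    circleHom_ext <| by
      rw [circleFC_coe, StarAlgHom.comp_apply, coe_rotate, ← circleFC_coe u, ← map_smul]
      rfl
  rw [this]; rfl

/-- The unitary `f(u)` for continuous `f : 𝕋 → 𝕋`. -/
def circleFCUnitary (u : unitary B) (f : C(Circle, Circle)) : unitary B :=
  ⟨circleFC u (circleCoe.comp f), by
    have h1 : star (circleCoe.comp f) * circleCoe.comp f = 1 := 
      ContinuousMap.ext fun z => star_coe_mul_coe (f z)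
    rw [Unitary.mem_iff, ← map_star, ← map_mul, ← map_mul, h1, mul_comm, h1, map_one]
    exact ⟨rfl, rfl⟩⟩

theorem coe_circleFCUnitary (u : unitary B) (f : C(Circle, Circle)) :
    (circleFCUnitary u f : B) = circleFC u (circleCoe.comp f) := rfl

theorem commute_circleFCUnitary (u : unitary B) (f : C(Circle, Circle)) :
    (u : B) * circleFCUnitary u f = circleFCUnitary u f * u := by
  rw [coe_circleFCUnitary, ← circleFC_coe u, ← map_mul, mul_comm, map_mul, circleFC_coe]

theorem torusRelation_anzai (z : Circle) (f : C(Circle, Circle)) :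
    TorusRelation α (rotate z (U α)) (circleFCUnitary (U α) f * V α) := by
  have h := torusRelation_U_V α
  unfold TorusRelation at h ⊢
  rw [coe_rotate, Submonoid.coe_mul, smul_mul_assoc, ← mul_assoc, commute_circleFCUnitary,
    mul_assoc, h, mul_smul_comm, mul_smul_comm, smul_comm, ← mul_assoc]

variable (α)

/-- The *-homomorphism with `U ↦ z U`, `V ↦ f(U) V`. -/
def anzaiHom (z : Circle) (f : C(Circle, Circle)) : NCTorus α →⋆ₐ[ℂ] NCTorus α :=
  lift (rotate z (U α)) (circleFCUnitary (U α) f * V α) (torusRelation_anzai z f)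

theorem anzaiHom_comp (z w : Circle) (f g : C(Circle, Circle)) :
    (anzaiHom α w g).comp (anzaiHom α z f) =
      anzaiHom α (z * w) (f.comp ⟨fun x => w * x, by fun_prop⟩ * g) := by
  apply hom_ext
  · simp only [StarAlgHom.comp_apply, anzaiHom, lift_U, coe_rotate, map_smul, smul_smul,
      Circle.coe_mul]
  · rw [StarAlgHom.comp_apply, anzaiHom, anzaiHom, anzaiHom, lift_V, lift_V, Submonoid.coe_mul,
      map_mul, lift_V, coe_circleFCUnitary,
      map_circleFC _ _ (rotate w (U α)) (lift_U _ _ _), circleFC_rotate, Submonoid.coe_mul,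
      Submonoid.coe_mul, ← mul_assoc, coe_circleFCUnitary, coe_circleFCUnitary, ← map_mul]
    rfl

theorem anzaiHom_one : anzaiHom α 1 1 = StarAlgHom.id ℂ (NCTorus α) := by
  apply hom_ext
  · simp [anzaiHom, coe_rotate]
  · rw [anzaiHom, lift_V, Submonoid.coe_mul, coe_circleFCUnitary]
    have : circleCoe.comp (1 : C(Circle, Circle)) = 1 := rfl
    rw [this, map_one, one_mul]; rfl

/-- The Anzai skew-product `Φ_{θ,f}`: the *-automorphism of `𝔸_α` with `U ↦ e^{iθ} U` and
`V ↦ f(U) V`, see `anzai_U` and `anzai_V`. -/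
def anzai (θ : ℝ) (f : C(Circle, Circle)) : NCTorus α ≃⋆ₐ[ℂ] NCTorus α :=
  StarAlgEquiv.ofStarAlgHom (anzaiHom α (Circle.exp θ) f)
    (anzaiHom α (Circle.exp (-θ)) (f.comp ⟨fun x => Circle.exp (-θ) * x, by fun_prop⟩)⁻¹)
    (by
      rw [anzaiHom_comp, ← Circle.exp_add, add_neg_cancel, Circle.exp_zero, mul_inv_cancel,
        anzaiHom_one])
    (by
      rw [anzaiHom_comp, ← Circle.exp_add, neg_add_cancel, Circle.exp_zero, ← anzaiHom_one]
      congr 1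
      ext z
      simp [← mul_assoc])

theorem anzai_U (θ : ℝ) (f : C(Circle, Circle)) :
    anzai α θ f (U α) = Complex.exp (θ * Complex.I) • (U α : NCTorus α) :=
  (lift_U _ _ (torusRelation_anzai _ f)).trans (by rw [coe_rotate, Circle.coe_exp])

theorem anzai_V (θ : ℝ) (f : C(Circle, Circle)) :
    anzai α θ f (V α) = circleFC (U α) (circleCoe.comp f) * V α :=
  lift_V _ _ (torusRelation_anzai _ f)

end NCTorus

/-- The Hilbert space `ℓ²(ℤ × ℤ)`. -/
abbrev TorusL2 : Type := lp (fun _ : ℤ × ℤ => ℂ) 2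

namespace NCTorus

variable (α : ℝ)

theorem memℓp_weighted (σ : ℤ × ℤ ≃ ℤ × ℤ) (c : ℤ × ℤ → Circle) (x : TorusL2) :
    Memℓp (fun i => (c i : ℂ) * x (σ i)) 2 := by
  have h := lp.memℓp x
  rw [memℓp_gen_iff (by simp)] at h ⊢
  simpa [Circle.norm_coe, Function.comp_def] using (σ.summable_iff (f := fun i => ‖x i‖ ^ (2 : ENNReal).toReal)).2 h

/-- The weighted permutation operator `(W x)(i) = c(i) x(σ(i))`. -/
def weighted (σ : ℤ × ℤ ≃ ℤ × ℤ) (c : ℤ × ℤ → Circle) : TorusL2 ≃ₗᵢ[ℂ] TorusL2 where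
  toFun x := ⟨fun i => (c i : ℂ) * x (σ i), memℓp_weighted σ c x⟩
  invFun x := ⟨fun i => ((c (σ.symm i))⁻¹ : Circle) * x (σ.symm i),
    memℓp_weighted σ.symm (fun i => (c (σ.symm i))⁻¹) x⟩
  map_add' x y := by ext i; exact mul_add _ _ _
  map_smul' r x := by ext i; exact mul_left_comm _ _ _
  left_inv x := by
    ext i
    simp
  right_inv x := by
    ext i
    simp
  norm_map' x := by
    rw [lp.norm_eq_tsum_rpow (by simp), lp.norm_eq_tsum_rpow (by simp)]
    congr 1
    simpa [Circle.norm_coe] using (σ.tsum_eq (f := fun i => ‖x i‖ ^ (2 : ENNReal).toReal))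

theorem weighted_apply (σ : ℤ × ℤ ≃ ℤ × ℤ) (c : ℤ × ℤ → Circle) (x : TorusL2) (i : ℤ × ℤ) :
    weighted σ c x i = (c i : ℂ) * x (σ i) := rfl

/-- `(U x)(m, n) = x(m - 1, n)`, i.e. `U e_{m,n} = e_{m+1,n}`. -/
def regU : unitary (TorusL2 →L[ℂ] TorusL2) :=
  Unitary.linearIsometryEquiv.symm
    (weighted (Equiv.addRight (-1, 0)) 1)

/-- `(V x)(m, n) = e^{-2πiαm} x(m, n - 1)`, i.e. `V e_{m,n} = e^{-2πiαm} e_{m,n+1}`. -/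
def regV : unitary (TorusL2 →L[ℂ] TorusL2) :=
  Unitary.linearIsometryEquiv.symm
    (weighted (Equiv.addRight (0, -1)) (fun i => Circle.exp (-(2 * Real.pi * α * i.1))))

theorem regU_apply (x : TorusL2) (i : ℤ × ℤ) :
    (regU : TorusL2 →L[ℂ] TorusL2) x i = x (i.1 - 1, i.2) := by
  have : (regU : TorusL2 →L[ℂ] TorusL2) x i = _ := weighted_apply _ _ x i
  rw [this]
  simp [Prod.add_def, sub_eq_add_neg]

theorem regV_apply (x : TorusL2) (i : ℤ × ℤ) :
    (regV α : TorusL2 →L[ℂ] TorusL2) x i =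
      Complex.exp (-(2 * Real.pi * Complex.I * α * i.1)) * x (i.1, i.2 - 1) := by
  have : (regV α : TorusL2 →L[ℂ] TorusL2) x i = _ := weighted_apply _ _ x i
  rw [this]
  simp only [Circle.coe_exp, Equiv.coe_addRight, Prod.add_def, sub_eq_add_neg, add_zero]
  congr 2
  push_cast; ring

theorem torusRelation_reg : TorusRelation α regU (regV α) := by
  refine ContinuousLinearMap.ext fun x => lp.ext <| funext fun i => ?_
  have h1 : ((regU : TorusL2 →L[ℂ] TorusL2) * (regV α : TorusL2 →L[ℂ] TorusL2)) x i = _ :=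
    (regU_apply _ i).trans (regV_apply α x _)
  have h2 : ((regV α : TorusL2 →L[ℂ] TorusL2) * (regU : TorusL2 →L[ℂ] TorusL2)) x i = _ :=
    (regV_apply α _ i).trans (congrArg _ (regU_apply x _))
  refine h1.trans (Eq.trans ?_ (congrArg (Complex.exp (2 * Real.pi * Complex.I * α) * ·) h2).symm)
  rw [← mul_assoc, ← Complex.exp_add]
  congr 2
  push_cast; ring

/-- The regular representation of `𝔸_α` on `ℓ²(ℤ × ℤ)`. -/
def regRep : NCTorus α →⋆ₐ[ℂ] (TorusL2 →L[ℂ] TorusL2) :=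
  lift regU (regV α) (torusRelation_reg α)

/-- The basis vector `e_{0,0}`. -/
def vac : TorusL2 := lp.single 2 (0, 0) (1 : ℂ)

/-- The canonical trace `τ`, the vector state of `e_{0,0}`. It is the unique bounded functional with
`τ(U^m V^n) = δ_{m,0} δ_{n,0}`, see `trace_zpow_mul_zpow`. -/
def trace : NCTorus α →L[ℂ] ℂ :=
  (innerSL ℂ vac).comp ((ContinuousLinearMap.apply ℂ TorusL2 vac).comp
    ⟨(regRep α : NCTorus α →ₗ[ℂ] (TorusL2 →L[ℂ] TorusL2)), continuous_starAlgHom (regRep α)⟩)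

theorem trace_apply (a : NCTorus α) : trace α a = inner ℂ vac (regRep α a vac) := rfl

theorem regU_zpow_apply (m : ℤ) (x : TorusL2) (i : ℤ × ℤ) :
    ((regU ^ m : unitary (TorusL2 →L[ℂ] TorusL2)) : TorusL2 →L[ℂ] TorusL2) x i =
      x (i.1 - m, i.2) := by
  induction m using Int.induction_on generalizing x i with
  | zero => simp
  | succ m ih =>
    rw [zpow_add_one]
    refine (ih _ i).trans ((regU_apply x _).trans ?_)
    simp [sub_sub]
  | pred m ih =>
    rw [zpow_sub_one]
    refine (ih _ i).trans ?_
    have h : (regU : TorusL2 →L[ℂ] TorusL2)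
        (((regU⁻¹ : unitary (TorusL2 →L[ℂ] TorusL2)) : TorusL2 →L[ℂ] TorusL2) x) = x :=
      DFunLike.congr_fun (congrArg Subtype.val (mul_inv_cancel regU)) x
    have h2 := regU_apply (((regU⁻¹ : unitary (TorusL2 →L[ℂ] TorusL2)) : TorusL2 →L[ℂ] TorusL2) x)
      (i.1 - (-m - 1), i.2)
    rw [h] at h2
    rw [h2]
    have e : i.1 - (-(m : ℤ) - 1) - 1 = i.1 - -(m : ℤ) := by ring
    simp only [e]
    rfl

theorem regV_zpow_apply (n : ℤ) (x : TorusL2) (i : ℤ × ℤ) :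
    ((regV α ^ n : unitary (TorusL2 →L[ℂ] TorusL2)) : TorusL2 →L[ℂ] TorusL2) x i =
      Complex.exp (-(2 * Real.pi * Complex.I * α * i.1)) ^ n * x (i.1, i.2 - n) := by
  induction n using Int.induction_on generalizing x i with
  | zero => simp
  | succ n ih =>
    rw [zpow_add_one]
    refine (ih _ i).trans ((congrArg _ (regV_apply α x _)).trans ?_)
    rw [← mul_assoc, ← zpow_add_one₀ (Complex.exp_ne_zero _), sub_sub]
  | pred n ih =>
    rw [zpow_sub_one]
    refine (ih _ i).trans ?_
    have h : (regV α : TorusL2 →L[ℂ] TorusL2)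
        ((((regV α)⁻¹ : unitary (TorusL2 →L[ℂ] TorusL2)) : TorusL2 →L[ℂ] TorusL2) x) = x :=
      DFunLike.congr_fun (congrArg Subtype.val (mul_inv_cancel (regV α))) x
    have h2 := regV_apply α ((((regV α)⁻¹ : unitary (TorusL2 →L[ℂ] TorusL2)) : TorusL2 →L[ℂ] TorusL2) x)
      (i.1, i.2 - (-n - 1))
    rw [h] at h2
    rw [h2, ← mul_assoc, ← zpow_add_one₀ (Complex.exp_ne_zero _)]
    have e : i.2 - (-(n : ℤ) - 1) - 1 = i.2 - -(n : ℤ) := by ring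
    have e2 : -(n : ℤ) - 1 + 1 = -(n : ℤ) := by ring
    simp only [e, e2]
    rfl

/-- The canonical trace satisfies `τ(U^m V^n) = δ_{m,0} δ_{n,0}`. -/
theorem trace_zpow_mul_zpow (m n : ℤ) :
    trace α ((U α ^ m * V α ^ n : unitary (NCTorus α)) : NCTorus α) =
      if m = 0 ∧ n = 0 then 1 else 0 := by
  let R : NCTorus α →⋆* (TorusL2 →L[ℂ] TorusL2) :=
    { toFun := regRep α
      map_one' := map_one _
      map_mul' := map_mul _
      map_star' := map_star _ }
  have hU : Unitary.map R (U α) = regU := Subtype.ext (lift_U _ _ (torusRelation_reg α))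
  have hV : Unitary.map R (V α) = regV α := Subtype.ext (lift_V _ _ (torusRelation_reg α))
  have h : regRep α ((U α ^ m * V α ^ n : unitary (NCTorus α)) : NCTorus α) =
      ((regU ^ m * regV α ^ n : unitary (TorusL2 →L[ℂ] TorusL2)) : TorusL2 →L[ℂ] TorusL2) := by
    rw [← hU, ← hV, ← map_zpow, ← map_zpow, ← map_mul]; rfl
  have h2 : ((regU ^ m * regV α ^ n : unitary (TorusL2 →L[ℂ] TorusL2)) :
      TorusL2 →L[ℂ] TorusL2) vac (0, 0) = _ :=
    (regU_zpow_apply m _ _).trans (regV_zpow_apply α n _ _)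
  have h3 : ∀ x : TorusL2, inner ℂ vac x = x (0, 0) := fun x =>
    (lp.inner_single_left (0, 0) (1 : ℂ) x).trans (by simp)
  rw [trace_apply, h, h3, h2, vac, lp.single_apply, Pi.single_apply]
  by_cases hm : m = 0
  · by_cases hn : n = 0
    · simp [hm, hn]
    · simp [hm, hn]
  · simp [hm]

end NCTorus

section states
variable {A : Type*} [CStarAlgebra A]
open scoped ComplexOrder in
/-- The states of a unital C*-algebra: the positive functionals with value one at the identity. -/
def stateSpace (A : Type*) [CStarAlgebra A] : Set (A →L[ℂ] ℂ) :=
  {φ | φ 1 = 1 ∧ ∀ a, 0 ≤ φ (star a * a)}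

/-- The states invariant under the *-automorphism `Φ`. -/
def invariantStates (Φ : A ≃⋆ₐ[ℂ] A) : Set (A →L[ℂ] ℂ) :=
  {φ | φ ∈ stateSpace A ∧ ∀ a, φ (Φ a) = φ a}

/-- The system `(A, Φ, φ)` is ergodic: `φ` is an extreme point of the convex set of invariant
states. -/
def IsErgodicState (Φ : A ≃⋆ₐ[ℂ] A) (φ : A →L[ℂ] ℂ) : Prop :=
  φ ∈ (invariantStates Φ).extremePoints ℝ

/-- The system `(A, Φ)` is uniquely ergodic: there is exactly one invariant state. -/
def IsUniquelyErgodic (Φ : A ≃⋆ₐ[ℂ] A) : Prop := ∃! φ, φ ∈ invariantStates Φ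

end states

end

open MeasureTheory

/-- In a group where `u v = ζ v u` with `ζ` central, every word in `u` and `v` can be brought
to the normal form `ζ ^ k * u ^ m * v ^ n`. -/
theorem freeGroup_exists_lift_eq_zpow_mul_zpow {G : Type*} [Group G] {ζ u v : G}
    (hζ : ∀ g, Commute ζ g) (h : u * v = ζ * (v * u)) (g : FreeGroup (Fin 2)) :
    ∃ k m n : ℤ, FreeGroup.lift ![u, v] g = ζ ^ k * (u ^ m * v ^ n) := by
  have hs : SemiconjBy v u (ζ⁻¹ * u) := by
    change v * u = ζ⁻¹ * u * v
    rw [mul_assoc, h, inv_mul_cancel_left]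
  have hs' : SemiconjBy v⁻¹ u (ζ * u) := by
    change v⁻¹ * u = ζ * u * v⁻¹
    rw [eq_mul_inv_iff_mul_eq, mul_assoc, h, (hζ _).left_comm, inv_mul_cancel_left]
  have key : ∀ k m n : ℤ, ∃ k' m' n' : ℤ,
      FreeGroup.lift ![u, v] g * (ζ ^ k * (u ^ m * v ^ n)) = ζ ^ k' * (u ^ m' * v ^ n') := by
    induction g using FreeGroup.induction_on with
    | C1 => exact fun k m n => ⟨k, m, n, by simp⟩
    | of i =>
      intro k m n
      fin_cases i
      · refine ⟨k, m + 1, n, ?_⟩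
        simp only [FreeGroup.lift_apply_of, Fin.zero_eta, Matrix.cons_val_zero]
        rw [((hζ u).zpow_left k).symm.left_comm, ← mul_assoc u, zpow_add, zpow_one,
          ((Commute.refl u).zpow_right m).eq]
      · refine ⟨k - m, m, n + 1, ?_⟩
        simp only [FreeGroup.lift_apply_of, Fin.mk_one, Matrix.cons_val_one, Matrix.cons_val_fin_one]
        rw [((hζ v).zpow_left k).symm.left_comm, ← mul_assoc v, (hs.zpow_right m).eq,
          (hζ u).inv_left.mul_zpow, inv_zpow', zpow_sub, zpow_add, zpow_one, zpow_neg,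
          ((Commute.refl v).zpow_left n).eq]
        simp only [mul_assoc]
    | inv_of i _ =>
      intro k m n
      fin_cases i
      · refine ⟨k, m - 1, n, ?_⟩
        simp only [map_inv, FreeGroup.lift_apply_of, Fin.zero_eta, Matrix.cons_val_zero]
        rw [((hζ u⁻¹).zpow_left k).symm.left_comm, ← mul_assoc u⁻¹, zpow_sub, zpow_one,
          ((Commute.refl u).inv_left.zpow_right m).eq]
      · refine ⟨k + m, m, n - 1, ?_⟩
        simp only [map_inv, FreeGroup.lift_apply_of, Fin.mk_one, Matrix.cons_val_one,
          Matrix.cons_val_fin_one]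
        rw [((hζ v⁻¹).zpow_left k).symm.left_comm, ← mul_assoc v⁻¹, (hs'.zpow_right m).eq,
          (hζ u).mul_zpow, zpow_add, zpow_sub, zpow_one,
          ((Commute.refl v).inv_right.zpow_left n).eq]
        simp only [mul_assoc]
    | mul x y hx hy =>
      intro k m n
      obtain ⟨k₁, m₁, n₁, h₁⟩ := hy k m n
      obtain ⟨k₂, m₂, n₂, h₂⟩ := hx k₁ m₁ n₁
      exact ⟨k₂, m₂, n₂, by rw [map_mul, mul_assoc, h₁, h₂]⟩
  simpa using key 0 0 0

namespace NCTorus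

section rotate
variable {B : Type*} [CStarAlgebra B]

theorem rotate_zpow (z : Circle) (u : unitary B) (n : ℤ) :
    rotate z u ^ n = rotate (z ^ n) (u ^ n) := by
  have hr : ∀ (w : Circle) (x : unitary B), rotate w x = rotate w 1 * x := fun w x =>
    Subtype.ext (by simp [coe_rotate])
  have hc : Commute (rotate z (1 : unitary B)) u := Subtype.ext (by simp [coe_rotate])
  let R : Circle →* unitary B :=
    { toFun := fun w => rotate w 1
      map_one' := Subtype.ext (by simp [coe_rotate])
      map_mul' := fun w w' => Subtype.ext (by simp [coe_rotate, smul_smul, mul_comm]) }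
  rw [hr z u, hc.mul_zpow, hr (z ^ n), show rotate (z ^ n) (1 : unitary B) = R (z ^ n) from rfl,
    map_zpow]
  rfl

theorem coe_rotate_zpow (z : Circle) (u : unitary B) (n : ℤ) :
    ((rotate z u ^ n : unitary B) : B) = ((z : ℂ) ^ n) • ((u ^ n : unitary B) : B) := by
  rw [rotate_zpow, coe_rotate, Circle.coe_zpow]

theorem map_coe_zpow {A : Type*} [CStarAlgebra A] (φ : A →⋆ₐ[ℂ] B) {u : unitary A}
    {v : unitary B} (h : φ u = v) (n : ℤ) :
    φ ((u ^ n : unitary A) : A) = ((v ^ n : unitary B) : B) := by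
  let R : A →⋆* B :=
    { toFun := φ
      map_one' := map_one _
      map_mul' := map_mul _
      map_star' := map_star _ }
  have hv : Unitary.map R u = v := Subtype.ext h
  rw [← hv, ← map_zpow]; rfl

end rotate

variable (α : ℝ)

/-- Every word in `U` and `V` is a scalar multiple of a monomial `U ^ m * V ^ n`. -/
theorem exists_ofPre_word_eq_smul (g : FreeGroup (Fin 2)) :
    ∃ (c : ℂ) (m n : ℤ), ofPre α (Pre.word α g) =
      c • ((U α ^ m * V α ^ n : unitary (NCTorus α)) : NCTorus α) := by
  set q : Circle := Circle.exp (2 * Real.pi * α) with hq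
  have hζ : ∀ x : unitary (NCTorus α), Commute (rotate q 1) x := fun x =>
    Subtype.ext (by simp [coe_rotate])
  have hrel : U α * V α = rotate q 1 * (V α * U α) := by
    refine Subtype.ext ((torusRelation_U_V α).trans ?_)
    simp only [Submonoid.coe_mul, coe_rotate, hq, Circle.coe_exp, OneMemClass.coe_one,
      smul_mul_assoc, one_mul]
    congr 2
    push_cast; ring
  obtain ⟨k, m, n, h⟩ := freeGroup_exists_lift_eq_zpow_mul_zpow hζ hrel g
  have hl : word α = FreeGroup.lift ![U α, V α] := by
    ext i
    fin_cases i <;> simp [U, V]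
  refine ⟨(q : ℂ) ^ k, m, n, ?_⟩
  rw [← hl] at h
  refine (congrArg Subtype.val h).trans ?_
  rw [Submonoid.coe_mul, coe_rotate_zpow, one_zpow, OneMemClass.coe_one, smul_mul_assoc, one_mul]

/-- A property of elements of `𝔸_α` that holds for the monomials `U ^ m * V ^ n`, and that is
linear and closed, holds everywhere. -/
theorem induction_monomial {P : NCTorus α → Prop} (x : NCTorus α) (hc : IsClosed {x | P x})
    (hm : ∀ m n : ℤ, P ((U α ^ m * V α ^ n : unitary (NCTorus α)) : NCTorus α))
    (ha : ∀ x y, P x → P y → P (x + y)) (hs : ∀ (c : ℂ) x, P x → P (c • x)) : P x := by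
  refine induction α x hc fun x => ?_
  induction x using Pre.induction α with
  | hw g =>
    obtain ⟨c, m, n, h⟩ := exists_ofPre_word_eq_smul α g
    rw [h]
    exact hs c _ (hm m n)
  | ha x y hx hy => rw [map_add]; exact ha _ _ hx hy
  | hs c x hx => rw [map_smul]; exact hs c _ hx

theorem functional_ext {φ ψ : NCTorus α →L[ℂ] ℂ}
    (h : ∀ m n : ℤ, φ ((U α ^ m * V α ^ n : unitary (NCTorus α)) : NCTorus α) =
      ψ ((U α ^ m * V α ^ n : unitary (NCTorus α)) : NCTorus α)) : φ = ψ :=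
  ContinuousLinearMap.ext fun x => induction_monomial α (P := fun x => φ x = ψ x) x
    (isClosed_eq φ.continuous ψ.continuous) h
    (fun x y hx hy => by rw [map_add, map_add, hx, hy])
    (fun c x hx => by rw [map_smul, map_smul, hx])

theorem torusRelation_gauge (z : Circle) : TorusRelation α (U α) (rotate z (V α)) := by
  have h := torusRelation_U_V α
  unfold TorusRelation at h ⊢
  rw [coe_rotate, mul_smul_comm, h, smul_mul_assoc, smul_comm]

/-- The gauge action of the circle on `𝔸_α`: `U ↦ U`, `V ↦ z V`. -/
noncomputable def gauge (z : Circle) : NCTorus α →⋆ₐ[ℂ] NCTorus α :=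
  lift (U α) (rotate z (V α)) (torusRelation_gauge α z)

theorem gauge_monomial (z : Circle) (m n : ℤ) :
    gauge α z ((U α ^ m * V α ^ n : unitary (NCTorus α)) : NCTorus α) =
      ((z : ℂ) ^ n) • ((U α ^ m * V α ^ n : unitary (NCTorus α)) : NCTorus α) := by
  rw [Submonoid.coe_mul, map_mul, map_coe_zpow (gauge α z) (lift_U _ _ _) m,
    map_coe_zpow (gauge α z) (lift_V _ _ _) n, coe_rotate_zpow, mul_smul_comm]

theorem norm_gauge_le (z : Circle) (a : NCTorus α) : ‖gauge α z a‖ ≤ ‖a‖ :=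
  NonUnitalStarAlgHom.norm_apply_le (gauge α z) a

theorem continuous_gauge (a : NCTorus α) : Continuous fun z => gauge α z a := by
  refine induction_monomial α (P := fun a => Continuous fun z => gauge α z a) a ?_ ?_ ?_ ?_
  · refine isClosed_of_closure_subset fun a ha => ?_
    refine continuous_of_uniform_approx_of_continuous fun u hu => ?_
    obtain ⟨ε, hε, hεu⟩ := Metric.mem_uniformity_dist.1 hu
    obtain ⟨b, hb, hab⟩ := Metric.mem_closure_iff.1 ha ε hε
    refine ⟨fun z => gauge α z b, hb, fun z => hεu ?_⟩
    rw [dist_eq_norm] at hab ⊢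
    rw [← map_sub]
    exact (norm_gauge_le α z _).trans_lt hab
  · intro m n
    simp_rw [gauge_monomial, ← Circle.coe_zpow]
    exact ((continuous_subtype_val (p := fun z : ℂ => z ∈ Submonoid.unitSphere ℂ)).comp
      (continuous_zpow (G := Circle) n)).smul continuous_const
  · intro x y hx hy
    simp_rw [map_add]
    exact hx.add hy
  · intro c x hx
    simp_rw [map_smul]
    exact hx.const_smul c

/-- The gauge action commutes with the Anzai skew-products. -/
theorem gauge_anzai (z : Circle) (θ : ℝ) (f : C(Circle, Circle)) (a : NCTorus α) :
    gauge α z (anzai α θ f a) = anzai α θ f (gauge α z a) := by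
  have hU : gauge α z (U α) = U α := lift_U _ _ _
  have hV : gauge α z (V α) = (z : ℂ) • (V α : NCTorus α) := lift_V _ _ _
  have : (gauge α z).comp (anzai α θ f : NCTorus α →⋆ₐ[ℂ] NCTorus α) =
      (anzai α θ f : NCTorus α →⋆ₐ[ℂ] NCTorus α).comp (gauge α z) := by
    apply hom_ext
    · change gauge α z (anzai α θ f (U α)) = anzai α θ f (gauge α z (U α))
      rw [hU, anzai_U, map_smul, hU]
    · change gauge α z (anzai α θ f (V α)) = anzai α θ f (gauge α z (V α))
      rw [hV, anzai_V, map_smul, anzai_V, map_mul, map_circleFC _ _ (U α) hU, hV, mul_smul_comm]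
  exact DFunLike.congr_fun this a

local instance : Fact ((0 : ℝ) < 1) := ⟨one_pos⟩

variable {α}

theorem continuous_gaugeOrbit (φ : NCTorus α →L[ℂ] ℂ) (w : C(AddCircle (1 : ℝ), ℂ))
    (a : NCTorus α) : Continuous fun t => w t * φ (gauge α t.toCircle a) :=
  w.continuous.mul
    (φ.continuous.comp ((continuous_gauge α a).comp AddCircle.continuous_toCircle))

theorem integrable_gaugeOrbit (φ : NCTorus α →L[ℂ] ℂ) (w : C(AddCircle (1 : ℝ), ℂ))
    (a : NCTorus α) :
    Integrable (fun t => w t * φ (gauge α t.toCircle a)) (AddCircle.haarAddCircle) :=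
  (continuous_gaugeOrbit φ w a).integrable_of_hasCompactSupport
    (HasCompactSupport.of_compactSpace _)

/-- The average `∫ w(z) φ ∘ γ_z dz` of a functional over the gauge action with weight `w`. -/
noncomputable def gaugeAverage (w : C(AddCircle (1 : ℝ), ℂ)) (φ : NCTorus α →L[ℂ] ℂ) : NCTorus α →L[ℂ] ℂ :=
  LinearMap.mkContinuous
    { toFun := fun a => ∫ t, w t * φ (gauge α t.toCircle a) ∂AddCircle.haarAddCircle
      map_add' := fun a b => by
        rw [← integral_add (integrable_gaugeOrbit φ w a) (integrable_gaugeOrbit φ w b)]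
        simp_rw [map_add, mul_add]
      map_smul' := fun c a => by
        rw [RingHom.id_apply, ← integral_smul]
        simp_rw [map_smul, smul_eq_mul, mul_left_comm] }
    (‖w‖ * ‖φ‖) fun a => by
      refine (norm_integral_le_of_norm_le_const (C := ‖w‖ * ‖φ‖ * ‖a‖)
        (Filter.Eventually.of_forall fun t => ?_)).trans (by simp)
      rw [norm_mul, mul_assoc]
      refine mul_le_mul (w.norm_coe_le_norm t) ((φ.le_opNorm _).trans ?_) (norm_nonneg _)
        (norm_nonneg _)
      gcongr
      exact norm_gauge_le α _ a

theorem gaugeAverage_apply (w : C(AddCircle (1 : ℝ), ℂ)) (φ : NCTorus α →L[ℂ] ℂ)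
    (a : NCTorus α) : gaugeAverage w φ a =
      ∫ t, w t * φ (gauge α t.toCircle a) ∂AddCircle.haarAddCircle := rfl

theorem integral_fourier (n : ℤ) :
    ∫ t : AddCircle (1 : ℝ), fourier n t ∂AddCircle.haarAddCircle = if n = 0 then 1 else 0 := by
  have h := congrFun (fourierCoeff_fourier (T := 1) n) 0
  simp only [fourierCoeff, neg_zero, fourier_zero, one_smul, Pi.single_apply] at h
  rw [h]
  simp only [eq_comm]

theorem gaugeAverage_monomial (w : C(AddCircle (1 : ℝ), ℂ)) (φ : NCTorus α →L[ℂ] ℂ) (m n : ℤ) :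
    gaugeAverage w φ ((U α ^ m * V α ^ n : unitary (NCTorus α)) : NCTorus α) =
      (∫ t, w t * fourier n t ∂AddCircle.haarAddCircle) *
        φ ((U α ^ m * V α ^ n : unitary (NCTorus α)) : NCTorus α) := by
  rw [gaugeAverage_apply, ← integral_mul_const]
  refine integral_congr_ae (Filter.Eventually.of_forall fun t => ?_)
  simp only [gauge_monomial, map_smul, smul_eq_mul, fourier_apply, AddCircle.toCircle_zsmul,
    Circle.coe_zpow, mul_assoc]

open scoped ComplexOrder in
theorem gaugeAverage_mem_invariantStates {θ : ℝ} {f : C(Circle, Circle)}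
    {φ : NCTorus α →L[ℂ] ℂ} (hφ : φ ∈ invariantStates (anzai α θ f))
    {w : C(AddCircle (1 : ℝ), ℂ)} (hw : ∀ t, 0 ≤ w t)
    (hw1 : ∫ t, w t ∂AddCircle.haarAddCircle = 1) :
    gaugeAverage w φ ∈ invariantStates (anzai α θ f) := by
  obtain ⟨⟨h1, hpos⟩, hinv⟩ := hφ
  refine ⟨⟨?_, fun a => ?_⟩, fun a => ?_⟩
  · simp_rw [gaugeAverage_apply, map_one, h1, mul_one, hw1]
  · refine integral_nonneg fun t => mul_nonneg (hw t) ?_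
    rw [map_mul, map_star]
    exact hpos _
  · simp_rw [gaugeAverage_apply, gauge_anzai, hinv]

/-- The weight `1 + s Re z ^ n` on the circle. -/
noncomputable def cosWeight (s : ℝ) (n : ℤ) : C(AddCircle (1 : ℝ), ℂ) :=
  1 + ((s : ℂ) / 2) • (fourier n + fourier (-n))

theorem cosWeight_apply (s : ℝ) (n : ℤ) (t : AddCircle (1 : ℝ)) :
    cosWeight s n t = 1 + (s : ℂ) / 2 * (fourier n t + fourier (-n) t) := rfl

open scoped ComplexOrder in
theorem cosWeight_nonneg {s : ℝ} (hs : |s| ≤ 1) (n : ℤ) (t : AddCircle (1 : ℝ)) :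
    0 ≤ cosWeight s n t := by
  have h : cosWeight s n t = ((1 + s * (fourier n t).re : ℝ) : ℂ) := by
    rw [cosWeight_apply, fourier_neg, Complex.add_conj]
    push_cast; ring
  have hn : |(fourier n t).re| ≤ 1 :=
    (Complex.abs_re_le_norm _).trans (by rw [fourier_apply, Circle.norm_coe])
  have := (abs_le.1 ((abs_mul s _).trans_le (mul_le_one₀ hs (abs_nonneg _) hn))).1
  rw [h, Complex.zero_le_real]
  linarith

theorem integral_cosWeight_mul_fourier (s : ℝ) (n k : ℤ) :
    ∫ t, cosWeight s n t * fourier k t ∂AddCircle.haarAddCircle =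
      (if k = 0 then 1 else 0) +
        (s : ℂ) / 2 * ((if n + k = 0 then 1 else 0) + (if -n + k = 0 then 1 else 0)) := by
  have hi : ∀ j : ℤ, Integrable (fun t : AddCircle (1 : ℝ) => fourier j t)
      AddCircle.haarAddCircle := fun j =>
    (fourier j).continuous.integrable_of_hasCompactSupport (HasCompactSupport.of_compactSpace _)
  simp_rw [cosWeight_apply, add_mul, one_mul, mul_assoc, add_mul, ← fourier_add]
  have hadd : Integrable (fun t : AddCircle (1 : ℝ) => fourier (n + k) t + fourier (-n + k) t)
      AddCircle.haarAddCircle := (hi _).add (hi _)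
  rw [integral_add (hi k) (hadd.const_mul _), integral_const_mul, integral_add (hi _) (hi _),
    integral_fourier, integral_fourier, integral_fourier]

/-- An invariant state vanishes on the nontrivial powers of `U` when the rotation is irrational. -/
theorem apply_U_zpow_eq_zero {θ : ℝ} (hθ : Irrational (θ / (2 * Real.pi)))
    {f : C(Circle, Circle)} {φ : NCTorus α →L[ℂ] ℂ} (hφ : φ ∈ invariantStates (anzai α θ f))
    {m : ℤ} (hm : m ≠ 0) : φ ((U α ^ m : unitary (NCTorus α)) : NCTorus α) = 0 := by
  have hU : anzai α θ f ((U α ^ m : unitary (NCTorus α)) : NCTorus α) =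
      ((Circle.exp θ : ℂ) ^ m) • ((U α ^ m : unitary (NCTorus α)) : NCTorus α) := by
    rw [← coe_rotate_zpow]
    refine map_coe_zpow (anzai α θ f : NCTorus α →⋆ₐ[ℂ] NCTorus α) ?_ m
    rw [coe_rotate, Circle.coe_exp]
    exact anzai_U α θ f
  have h := hφ.2 ((U α ^ m : unitary (NCTorus α)) : NCTorus α)
  rw [hU, map_smul, smul_eq_mul] at h
  refine (mul_left_eq_self₀.1 h).resolve_left fun he => ?_
  rw [Circle.coe_exp, ← Complex.exp_int_mul, Complex.exp_eq_one_iff] at he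
  obtain ⟨k, hk⟩ := he
  have hk' : (m : ℝ) * θ = k * (2 * Real.pi) := by
    have : (((m : ℝ) * θ : ℝ) : ℂ) * Complex.I = ((k * (2 * Real.pi) : ℝ) : ℂ) * Complex.I := by
      push_cast
      linear_combination hk
    exact_mod_cast mul_right_cancel₀ Complex.I_ne_zero this
  refine hθ ⟨(k : ℚ) / m, ?_⟩
  have : (m : ℝ) ≠ 0 := Int.cast_ne_zero.2 hm
  push_cast
  rw [div_eq_div_iff this (by positivity)]
  linarith

/-- If the canonical trace is ergodic, it is the only invariant state. -/
theorem eq_trace_of_isErgodicState {θ : ℝ} (hθ : Irrational (θ / (2 * Real.pi)))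
    {f : C(Circle, Circle)} (h : IsErgodicState (anzai α θ f) (trace α))
    {φ : NCTorus α →L[ℂ] ℂ} (hφ : φ ∈ invariantStates (anzai α θ f)) : φ = trace α := by
  have hU : ∀ m : ℤ, φ ((U α ^ m : unitary (NCTorus α)) : NCTorus α) = if m = 0 then 1 else 0 := by
    intro m
    split_ifs with hm
    · rw [hm, zpow_zero]
      exact hφ.1.1
    · exact apply_U_zpow_eq_zero hθ hφ hm
  refine functional_ext α fun m n => ?_
  rw [trace_zpow_mul_zpow]
  rcases eq_or_ne n 0 with rfl | hn
  · simpa using hU m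
  have hmem : ∀ s : ℝ, |s| ≤ 1 →
      gaugeAverage (cosWeight s n) φ ∈ invariantStates (anzai α θ f) := fun s hs =>
    gaugeAverage_mem_invariantStates hφ (cosWeight_nonneg hs n) (by
      simpa [hn] using integral_cosWeight_mul_fourier s n 0)
  have hmid : trace α ∈ openSegment ℝ (gaugeAverage (cosWeight 1 n) φ)
      (gaugeAverage (cosWeight (-1) n) φ) := by
    refine ⟨1 / 2, 1 / 2, by norm_num, by norm_num, by norm_num, functional_ext α fun i j => ?_⟩
    rw [trace_zpow_mul_zpow, _root_.add_apply, _root_.smul_apply,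
      _root_.smul_apply, gaugeAverage_monomial, gaugeAverage_monomial,
      integral_cosWeight_mul_fourier, integral_cosWeight_mul_fourier, Complex.real_smul,
      Complex.real_smul]
    rcases eq_or_ne j 0 with rfl | hj
    · have := hU i
      simp only [zpow_zero, mul_one, and_true, hn, neg_eq_zero, add_zero, if_true, if_false, this]
      push_cast; ring
    · simp only [hj, and_false, if_false]
      push_cast; ring
  have heq := ((mem_extremePoints.1 h).2 _ (hmem 1 (by simp)) _ (hmem (-1) (by simp)) hmid).1
  have hval := congrArg
    (fun ψ : NCTorus α →L[ℂ] ℂ => ψ ((U α ^ m * V α ^ n : unitary (NCTorus α)) : NCTorus α)) heq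
  simp only [gaugeAverage_monomial, integral_cosWeight_mul_fourier, trace_zpow_mul_zpow, hn,
    and_false, if_false, neg_add_cancel, if_true, ← two_mul, mul_eq_zero, OfNat.ofNat_ne_zero,
    or_false] at hval
  rw [if_neg (by simp [hn])]
  simpa using hval

end NCTorus

theorem mainTheorem2 (α θ : ℝ) (hθ : Irrational (θ / (2 * Real.pi))) (f : C(Circle, Circle))
    (h : IsErgodicState (NCTorus.anzai α θ f) (NCTorus.trace α)) :
    IsUniquelyErgodic (NCTorus.anzai α θ f) ∧
      invariantStates (NCTorus.anzai α θ f) = {NCTorus.trace α} := by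
  have hτ : NCTorus.trace α ∈ invariantStates (NCTorus.anzai α θ f) := (mem_extremePoints.1 h).1
  exact ⟨⟨_, hτ, fun _ hφ => NCTorus.eq_trace_of_isErgodicState hθ h hφ⟩,
    Set.eq_singleton_iff_unique_mem.2
      ⟨hτ, fun _ hφ => NCTorus.eq_trace_of_isErgodicState hθ h hφ⟩⟩
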